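/- Let $G$ be a graph and let $R$ be a natural number. In the game of cops and robbers on $G$ with a robber of speed $R$, a set of cops is first placed on vertices of $G$ (several cops may share a vertex), and then the robber, knowing this placement, chooses a vertex. Afterwards they move alternately, the cops first, with perfect information. In the cops' turn each cop moves to an adjacent vertex or stays where he is; in the robber's turn the robber takes a walk of length at most $R$ (possibly of length $0$) from his current vertex that does not pass through a vertex occupied by a cop. The cops win if at some time there is a cop at the vertex of the robber; otherwise the robber wins. Let $f_R(n)$ be the minimum number of cops that have a winning strategy on the $n \times n$ grid of squares, in which two squares are adjacent if and only if they share an edge. **Theorem.** There exist a natural number $R$ and a constant $c_R > 0$ such that for all sufficiently large natural numbers $n$, $$f_R(n) \ge \exp\left( \frac{c_R \log n}{\log \log n} \right).$$ In fact, this holds with $R = 10^{25}$. -/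

import Mathlib

/-- A strategy for `m` cops on the graph `G`, in the perfect information game. `pos h i` is the
vertex of cop `i` once the cops have seen the list `h` of all vertices chosen by the robber so far
(the initial vertex and then the end vertices of the robber's moves, in order of play): `pos []` is
the initial placement of the cops, and `pos (h ++ [v])` is the placement after the cops' answer to
`v`. In answering, each cop stays where he is or moves to an adjacent vertex. Several cops may
share a vertex. -/
structure CopStrategy {V : Type*} (G : SimpleGraph V) (m : ℕ) where
  pos : List V → Fin m → V
  step : ∀ (h : List V) (v : V) (i : Fin m),
    pos (h ++ [v]) i = pos h i ∨ G.Adj (pos h i) (pos (h ++ [v]) i)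

namespace CopStrategy

variable {V : Type*} {G : SimpleGraph V} {m : ℕ}

/-- The placement of the cops after their first `t` turns when the robber is successively at the
vertices `r 0, r 1, r 2, …`. At `t = 0` this is the initial placement; turn `t + 1` of the cops
takes place when the robber is at `r t`, and the robber then moves from `r t` to `r (t + 1)`. -/
def cops (σ : CopStrategy G m) (r : ℕ → V) (t : ℕ) : Fin m → V :=
  σ.pos ((List.range t).map r)

/-- At the moment the robber has just arrived at `r t`, or just after the turn of the cops which
follows, there is a cop at the vertex `r t` of the robber. -/
def CatchesAt (σ : CopStrategy G m) (r : ℕ → V) (t : ℕ) : Prop :=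
  ∃ i, σ.cops r t i = r t ∨ σ.cops r (t + 1) i = r t

end CopStrategy

/-- With the cops placed at the vertices `c`, a robber of speed `R` may move from `u` to `v`: there
is a walk of length at most `R` from `u` to `v` which avoids all vertices occupied by cops. -/
def RobberMove {V : Type*} (G : SimpleGraph V) (R : ℕ) {m : ℕ} (c : Fin m → V) (u v : V) : Prop :=
  ∃ w : G.Walk u v, w.length ≤ R ∧ ∀ x ∈ w.support, ∀ i, c i ≠ x

namespace CopStrategy

variable {V : Type*} {G : SimpleGraph V} {m : ℕ}

/-- The sequence `r` of robber vertices obeys the rules against the strategy `σ`: the initial vertex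
`r 0` is arbitrary, and as long as the robber has not been caught, he makes legal moves. -/
def IsPlay (σ : CopStrategy G m) (R : ℕ) (r : ℕ → V) : Prop :=
  ∀ t, (∀ s ≤ t, ¬ σ.CatchesAt r s) → RobberMove G R (σ.cops r (t + 1)) (r t) (r (t + 1))

/-- The strategy `σ` wins against a robber of speed `R`: however he plays, he is caught at some
time. -/
def Winning (σ : CopStrategy G m) (R : ℕ) : Prop :=
  ∀ r : ℕ → V, σ.IsPlay R r → ∃ t, σ.CatchesAt r t

end CopStrategy

/-- The least number of cops that have a winning strategy against a robber of speed `R` on `G`. -/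
noncomputable def copNumber {V : Type*} (G : SimpleGraph V) (R : ℕ) : ℕ :=
  sInf {m : ℕ | ∃ σ : CopStrategy G m, σ.Winning R}

/-- On a finite graph some number of cops suffices, so that the infimum is a minimum. -/
theorem exists_winning_copStrategy {V : Type*} [Finite V] (G : SimpleGraph V) (R : ℕ) :
    {m : ℕ | ∃ σ : CopStrategy G m, σ.Winning R}.Nonempty := by
  obtain ⟨n, ⟨e⟩⟩ := Finite.exists_equiv_fin V
  refine ⟨n, ⟨⟨fun _ => e.symm, fun _ _ _ => Or.inl rfl⟩, fun r _ => ⟨0, e (r 0), Or.inl ?_⟩⟩⟩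
  simp [CopStrategy.cops]

/-- The `n × n` grid of squares, two squares being adjacent iff they share an edge. -/
def gridGraph (n : ℕ) : SimpleGraph (Fin n × Fin n) :=
  SimpleGraph.boxProd (SimpleGraph.pathGraph n) (SimpleGraph.pathGraph n)

/-- The least number `f_R(n)` of cops needed to catch a robber of speed `R` on the `n × n` grid. -/
noncomputable def gridCopNumber (R n : ℕ) : ℕ :=
  copNumber (gridGraph n) R

/-! The robber plays on cells of side `10 ^ 4 * m ^ i`, for all scales `i ≤ k` at once, and the
number of cops needed to stop him doubles with each scale. A level `i + 1` cell is made of `m × m`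
level `i` cells. If fewer than `2 ^ (i + 1)` cops are in the vicinity, a level `i` move can be
obstructed only by `2 ^ i` of them crowding around one place. These are more than half of the cops
in the vicinity, so their coordinatewise median is at that place too. The whole group thus acts as a
single virtual cop, whose coordinates change by at most one per turn. During a level `i` move it
drifts by at most a thousandth of a cell, so the robber walks around it with at most 57 extra moves
(`dodge`). This is the inductive step `cell_step_succ`; the base `cell_step_zero` is where the
robber's speed enters.

Each level costs a factor `1 + 57 / m` in speed. For `m = 60 * k` the total loss over `k` levels is
less than 3, which the margin between `10 ^ 4` and `1000` absorbs (`speed_loss_bound`). So against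
fewer than `2 ^ k` cops the robber shuttles forever between two adjacent level `k` cells
(`two_pow_le_of_winning`). This needs `n` of size about `(60 * k) ^ k`, which allows `k` of order
`log n / log log n`. Any speed from 40000 on suffices. -/

/-! ### Positions that the robber can force -/

/-- A position of the game in which the cops are to move, together with a clock. -/
structure GameState (V : Type*) (M : ℕ) where
  time : ℕ
  cops : Fin M → V
  robber : V

/-- Each cop stays where he is or moves to an adjacent vertex. -/
def CopMove {V : Type*} (G : SimpleGraph V) {M : ℕ} (c c' : Fin M → V) : Prop :=
  ∀ i, c' i = c i ∨ G.Adj (c i) (c' i)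

/-- The robber can force the game to reach a position satisfying `P` without being caught. -/
inductive RobberForces {V : Type*} (G : SimpleGraph V) (R : ℕ) {M : ℕ}
    (P : GameState V M → Prop) : GameState V M → Prop
  | done (s : GameState V M) : P s → RobberForces G R P s
  | step (s : GameState V M) (f : (Fin M → V) → V)
      (hmove : ∀ c', CopMove G s.cops c' → RobberMove G R c' s.robber (f c'))
      (hrec : ∀ c', CopMove G s.cops c' → RobberForces G R P ⟨s.time + 1, c', f c'⟩) :
      RobberForces G R P s

namespace RobberForces

variable {V : Type*} {G : SimpleGraph V} {R M : ℕ} {P Q : GameState V M → Prop}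

theorem trans {s : GameState V M} (h : RobberForces G R P s)
    (hPQ : ∀ s', P s' → RobberForces G R Q s') : RobberForces G R Q s := by
  induction h with
  | done s hs => exact hPQ s hs
  | step s f hmove _ ih => exact .step s f hmove ih

theorem mono {s : GameState V M} (h : RobberForces G R P s) (hPQ : ∀ s', P s' → Q s') :
    RobberForces G R Q s :=
  h.trans fun s' hs' => .done s' (hPQ s' hs')

theorem iterate (J : ℕ → GameState V M → Prop) (N : ℕ)
    (hJ : ∀ j < N, ∀ s, J j s → RobberForces G R (J (j + 1)) s) {s : GameState V M} (h : J 0 s) :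
    RobberForces G R (J N) s := by
  induction N with
  | zero => exact .done s h
  | succ N ih =>
    exact (ih fun j hj => hJ j (by omega)).trans (hJ N (by omega))

/-- A quantity of the cops that changes by at most one in each of their moves changes by at most the
time that elapses. -/
theorem with_drift {s : GameState V M} (h : RobberForces G R P s) :
    RobberForces G R (fun s' => P s' ∧ s.time ≤ s'.time ∧ ∀ f : (Fin M → V) → ℤ,
      (∀ c c', CopMove G c c' → |f c' - f c| ≤ 1) →
        |f s'.cops - f s.cops| ≤ (s'.time : ℤ) - s.time) s := by
  induction h with
  | done s hs => exact .done s ⟨hs, le_rfl, by simp⟩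
  | step s f' hmove _ ih =>
    refine .step s f' hmove fun c' hc' => (ih c' hc').mono fun s' hs' =>
      ⟨hs'.1, ?_, fun f hf => ?_⟩
    · have := hs'.2.1
      simp only at this
      omega
    · have h1 := hs'.2.2 f hf
      have h2 := hf _ _ hc'
      push_cast at h1
      rw [abs_le] at *
      constructor <;> linarith

end RobberForces

/-! ### Walking around one slow point -/

/-- The point `(bx, by)` lies at distance at least `r` cells of side `L` from the cell `(X, Y)`. -/
def FarFromCell (L r X Y bx by' : ℤ) : Prop :=
  bx ≤ (X - r) * L ∨ (X + 1 + r) * L ≤ bx ∨ by' ≤ (Y - r) * L ∨ (Y + 1 + r) * L ≤ by'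

section Dodge

variable {V : Type*} {G : SimpleGraph V} {R M : ℕ}

/-- A robber who moves from cell to cell in a `2m × m` rectangle, and who can be stopped only near
a slow moving point `(bx, by)`, passes from the first half of the rectangle to the second. -/
theorem dodge (m L τ t₀ : ℤ) (hm : 60 ≤ m) (hτ : 0 ≤ τ) (hL : 1000 * τ ≤ L)
    (bx by' : GameState V M → ℤ) (Cell : ℤ → ℤ → GameState V M → Prop)
    (Inv Light : GameState V M → Prop)
    (hmove : ∀ s X Y X' Y', Inv s → Cell X Y s → Light s → 0 ≤ X → X < 2 * m → 0 ≤ Y → Y < m →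
      0 ≤ X' → X' < 2 * m → 0 ≤ Y' → Y' < m → |X' - X| + |Y' - Y| = 1 →
      RobberForces G R (fun s' => Inv s' ∧ Cell X' Y' s' ∧ (s'.time : ℤ) ≤ s.time + τ ∧
        |bx s' - bx s| ≤ τ ∧ |by' s' - by' s| ≤ τ) s)
    (hfar : ∀ s X Y, Inv s → Cell X Y s → 0 ≤ X → X < 2 * m → 0 ≤ Y → Y < m →
      (s.time : ℤ) ≤ t₀ + (m + 57) * τ → FarFromCell L 3 X Y (bx s) (by' s) → Light s)
    (s₀ : GameState V M) (X₀ Y₀ : ℤ) (hX₀ : 0 ≤ X₀) (hX₀' : X₀ < m) (hY₀ : 0 ≤ Y₀) (hY₀' : Y₀ < m)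
    (hInv : Inv s₀) (hCell : Cell X₀ Y₀ s₀) (ht₀ : (s₀.time : ℤ) ≤ t₀)
    (hstart : ∀ s Y, Inv s → Cell X₀ Y s → |Y - Y₀| ≤ 12 → (s.time : ℤ) ≤ t₀ + 12 * τ → Light s) :
    RobberForces G R (fun s' => Inv s' ∧ (s'.time : ℤ) ≤ t₀ + (m + 57) * τ ∧
      ∃ X Y, m ≤ X ∧ X < 2 * m ∧ 0 ≤ Y ∧ Y < m ∧ Cell X Y s' ∧
        FarFromCell L 20 X Y (bx s') (by' s')) s₀ := by
  set Goal : GameState V M → Prop := fun s' => Inv s' ∧ (s'.time : ℤ) ≤ t₀ + (m + 57) * τ ∧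
      ∃ X Y, m ≤ X ∧ X < 2 * m ∧ 0 ≤ Y ∧ Y < m ∧ Cell X Y s' ∧
        FarFromCell L 20 X Y (bx s') (by' s') with hGoal
  have hL0 : 0 ≤ L := by linarith
  have hτL : τ ≤ L := by linarith
  -- the point is behind the robber
  have behind : ∀ (d : ℕ) (s : GameState V M) (X Y : ℤ), m - d ≤ X → 0 ≤ X → X < m + 45 → 0 ≤ Y →
      Y < m → Inv s → Cell X Y s → bx s ≤ (X - 20) * L →
      (s.time : ℤ) ≤ t₀ + (X + 12) * τ → RobberForces G R Goal s := by
    intro d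
    induction d with
    | zero =>
      intro s X Y h1 h2 h3 h4 h5 hi hc hb ht
      -- Passing the point overshoots the middle by less than 45 columns, and changing rows costs at
      -- most 12 moves; this is the 57 in the time bound.
      refine .done s ⟨hi, by nlinarith, X, Y, by push_cast at h1; linarith, by linarith, h4, h5, hc, .inl hb⟩
    | succ d ih =>
      intro s X Y h1 h2 h3 h4 h5 hi hc hb ht
      push_cast at h1
      by_cases hX : m - d ≤ X
      · exact ih s X Y hX h2 h3 h4 h5 hi hc hb ht
      have hl : Light s := hfar s X Y hi hc h2 (by linarith) h4 h5 (by nlinarith)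
        (.inl (by nlinarith))
      refine (hmove s X Y (X + 1) Y hi hc hl h2 (by linarith) h4 h5 (by linarith) (by omega) h4 h5
        (by simp)).trans ?_
      rintro s' ⟨hi', hc', ht', hb', -⟩
      refine ih s' (X + 1) Y (by linarith) (by linarith) (by omega) h4 h5 hi' hc' ?_ ?_
      · have := (abs_le.1 hb').2
        linarith
      · linarith
  -- passing the point in a row far from it
  have pass : ∀ (s : GameState V M) (X Y : ℤ), 0 ≤ X → X < m → 0 ≤ Y → Y < m → Inv s →
      Cell X Y s → bx s ≤ (X + 24) * L + 12 * τ →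
      (by' s ≤ (Y - 4) * L ∨ (Y + 5) * L ≤ by' s) →
      (s.time : ℤ) ≤ t₀ + (X + 12) * τ → RobberForces G R Goal s := by
    intro s X Y h1 h2 h3 h4 hi hc hb hby ht
    -- The point is at most 24 cells ahead, up to a drift of `57 * τ ≤ L` in all, so after 45 moves
    -- it is at least 20 cells behind. As `m ≥ 60`, the robber is still inside the rectangle.
    refine (RobberForces.iterate (fun j s' => Inv s' ∧ Cell (X + j) Y s' ∧
      bx s' ≤ bx s + j * τ ∧ |by' s' - by' s| ≤ j * τ ∧ (s'.time : ℤ) ≤ t₀ + (X + j + 12) * τ) 45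
      ?_ ⟨hi, by simpa using hc, by simp, by simp, by simpa using ht⟩).trans ?_
    · rintro j hj s' ⟨hi', hc', hb', hby', ht'⟩
      have hj' : (j : ℤ) < 45 := by exact_mod_cast hj
      have hj0 : (0 : ℤ) ≤ j := by positivity
      have hjτ : (j : ℤ) * τ ≤ L := by nlinarith
      have hl : Light s' := by
        refine hfar s' (X + j) Y hi' hc' (by linarith) (by linarith) h3 h4 (by nlinarith) ?_
        obtain ⟨ha, hb⟩ := abs_le.1 hby'
        rcases hby with h | h
        · exact .inr (.inr (.inl (by linarith)))
        · exact .inr (.inr (.inr (by linarith)))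
      refine (hmove s' (X + j) Y (X + j + 1) Y hi' hc' hl (by linarith) (by linarith) h3 h4
        (by linarith) (by linarith) h3 h4 (by simp)).mono ?_
      rintro s'' ⟨hi'', hc'', ht'', hb'', hby''⟩
      obtain ⟨ha, hb⟩ := abs_le.1 hb''
      refine ⟨hi'', ?_, ?_, ?_, ?_⟩
      · push_cast
        rwa [← add_assoc]
      · push_cast
        linarith
      · obtain ⟨ha, hb⟩ := abs_le.1 hby''
        obtain ⟨ha', hb'⟩ := abs_le.1 hby'
        rw [abs_le]
        push_cast
        constructor <;> linarith
      · push_cast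
        linarith
    · rintro s' ⟨hi', hc', hb', -, ht'⟩
      push_cast at hc' hb' ht'
      refine behind (m - (X + 45)).toNat s' (X + 45) Y ?_ (by linarith) (by linarith) h3 h4 hi' hc'
        ?_ ht'
      · have := Int.self_le_toNat (m - (X + 45))
        linarith
      · linarith
  -- changing to such a row
  have evade : ∀ (s : GameState V M) (X Y : ℤ), 0 ≤ X → X < m → 0 ≤ Y → Y < m → Inv s →
      Cell X Y s → bx s ≤ (X + 24) * L → (s.time : ℤ) ≤ t₀ + X * τ →
      (∀ s' Y', 0 ≤ Y' → Y' < m → Inv s' → Cell X Y' s' → |Y' - Y| ≤ 12 →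
        (s'.time : ℤ) ≤ s.time + 12 * τ → |bx s' - bx s| ≤ 12 * τ → Light s') →
      RobberForces G R Goal s := by
    intro s X Y h1 h2 h3 h4 hi hc hb ht hlight
    obtain ⟨e, d, he, hd, hY, hY', hby⟩ : ∃ (e : ℤ) (d : ℕ), (e = 1 ∨ e = -1) ∧ d ≤ 12 ∧
        0 ≤ Y + e * d ∧ Y + e * d < m ∧
        (by' s ≤ (Y + e * d - 5) * L ∨ (Y + e * d + 6) * L ≤ by' s) := by
      obtain ⟨e, d, he, hd, hY, hY', hby⟩ : ∃ (e : ℤ) (d : ℕ), (e = 1 ∨ e = -1) ∧ d ≤ 12 ∧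
        0 ≤ Y + e * d ∧ Y + e * d < m ∧
        (by' s / L + 1 ≤ Y + e * d - 5 ∨ Y + e * d + 6 ≤ by' s / L) := by
        generalize by' s / L = β
        -- If the current row is too close, then `|β - Y| ≤ 5`, and a shift by 12 in either
        -- direction clears the point; `m ≥ 60` leaves room on one side.
        by_cases hβ : β + 1 ≤ Y - 5 ∨ Y + 6 ≤ β
        · exact ⟨1, 0, .inl rfl, by omega, by omega, by omega, by omega⟩
        · by_cases hu : Y + 12 < m
          · exact ⟨1, 12, .inl rfl, by omega, by omega, by omega, by omega⟩
          · exact ⟨-1, 12, .inr rfl, by omega, by omega, by omega, by omega⟩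
      refine ⟨e, d, he, hd, hY, hY', ?_⟩
      rcases hL0.eq_or_lt with h0 | h0
      · simp [← h0]
        exact le_total _ _
      have ha := Int.ediv_mul_le (by' s) h0.ne'
      have hb := Int.lt_ediv_add_one_mul_self (by' s) h0
      rcases hby with h | h
      · left
        nlinarith
      · right
        nlinarith
    refine (RobberForces.iterate (fun j s' => Inv s' ∧ Cell X (Y + e * j) s' ∧
      |bx s' - bx s| ≤ j * τ ∧ |by' s' - by' s| ≤ j * τ ∧ (s'.time : ℤ) ≤ s.time + j * τ) d
      ?_ ⟨hi, by simpa using hc, by simp, by simp, by simp⟩).trans ?_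
    · rintro j hj s' ⟨hi', hc', hb', hby', ht'⟩
      have hj' : (j : ℤ) ≤ 12 := by exact_mod_cast (by omega : j ≤ 12)
      have hj0 : (0 : ℤ) ≤ j := by positivity
      have hjτ : (j : ℤ) * τ ≤ 12 * τ := by nlinarith
      have hr : 0 ≤ Y + e * j ∧ Y + e * j < m ∧ |Y + e * j - Y| ≤ 12 ∧ 0 ≤ Y + e * (j + 1) ∧
          Y + e * (j + 1) < m ∧ |Y + e * (j + 1) - (Y + e * j)| = 1 := by
        have : (j : ℤ) < d := by exact_mod_cast hj
        rcases he with rfl | rfl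
        · refine ⟨by linarith, by linarith, ?_, by linarith, by linarith, ?_⟩
          · rw [abs_le]; constructor <;> linarith
          · ring_nf; simp
        · refine ⟨by linarith, by linarith, ?_, by linarith, by linarith, ?_⟩
          · rw [abs_le]; constructor <;> linarith
          · ring_nf; simp
      obtain ⟨r1, r2, r3, r4, r5, r6⟩ := hr
      have hl : Light s' := hlight s' (Y + e * j) r1 r2 hi' hc' r3 (by linarith) (by linarith)
      refine (hmove s' X (Y + e * j) X (Y + e * (j + 1)) hi' hc' hl h1 (by linarith) r1 r2 h1
        (by linarith) r4 r5 (by simpa using r6)).mono ?_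
      rintro s'' ⟨hi'', hc'', ht'', hb'', hby''⟩
      refine ⟨hi'', by push_cast; exact hc'', ?_, ?_, by push_cast; linarith⟩
      · rw [abs_le] at *
        push_cast
        constructor <;> linarith
      · rw [abs_le] at *
        push_cast
        constructor <;> linarith
    · rintro s' ⟨hi', hc', hb', hby', ht'⟩
      have hd' : (d : ℤ) ≤ 12 := by exact_mod_cast hd
      have hdτ : (d : ℤ) * τ ≤ 12 * τ := by nlinarith
      obtain ⟨ha1, ha2⟩ := abs_le.1 hb'
      obtain ⟨hb1, hb2⟩ := abs_le.1 hby'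
      refine pass s' X (Y + e * d) h1 h2 hY hY' hi' hc' (by linarith) ?_ (by linarith)
      rcases hby with h | h
      · left; linarith
      · right; linarith
  -- the point is well ahead of the robber
  have ahead : ∀ (d : ℕ) (s : GameState V M) (X Y : ℤ), m - d ≤ X → 0 ≤ X → X < m → 0 ≤ Y →
      Y < m → Inv s → Cell X Y s → (X + 21) * L ≤ bx s → (s.time : ℤ) ≤ t₀ + X * τ →
      RobberForces G R Goal s := by
    intro d
    induction d with
    | zero =>
      intro s X Y h1 h2 h3
      push_cast at h1
      omega
    | succ d ih =>
      intro s X Y h1 h2 h3 h4 h5 hi hc hb ht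
      push_cast at h1
      by_cases hX : bx s ≤ (X + 24) * L
      · refine evade s X Y h2 h3 h4 h5 hi hc hX ht ?_
        intro s' Y' hY hY' hi' hc' _ ht' hb'
        have := (abs_le.1 hb').1
        exact hfar s' X Y' hi' hc' h2 (by linarith) hY hY' (by nlinarith)
          (.inr (.inl (by linarith)))
      · have hl : Light s := hfar s X Y hi hc h2 (by linarith) h4 h5 (by nlinarith)
          (.inr (.inl (by linarith)))
        refine (hmove s X Y (X + 1) Y hi hc hl h2 (by linarith) h4 h5 (by linarith) (by omega) h4 h5
          (by simp)).trans ?_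
        rintro s' ⟨hi', hc', ht', hb', -⟩
        have := (abs_le.1 hb').1
        by_cases hXm : X + 1 < m
        · exact ih s' (X + 1) Y (by linarith) (by linarith) hXm h4 h5 hi' hc' (by linarith)
            (by linarith)
        · exact .done s' ⟨hi', by nlinarith, X + 1, Y, by linarith, by linarith, h4, h5, hc',
            .inr (.inl (by linarith))⟩
  by_cases hb : bx s₀ ≤ (X₀ + 24) * L
  -- Here the point may be right next to the robber, so the sideways moves rely on `hstart` and not
  -- on `hfar`.
  · refine evade s₀ X₀ Y₀ hX₀ hX₀' hY₀ hY₀' hInv hCell hb (by nlinarith) ?_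
    intro s' Y' _ _ hi' hc' hY' ht' _
    exact hstart s' Y' hi' hc' hY' (by linarith)
  · refine ahead (m - X₀).toNat s₀ X₀ Y₀ ?_ hX₀ hX₀' hY₀ hY₀' hInv hCell (by linarith)
      (by nlinarith)
    have := Int.self_le_toNat (m - X₀)
    linarith

end Dodge

/-! ### Order statistics as virtual cops -/

/-- The `a`-th smallest of the values of `f` on `S` (zero if there are fewer values). -/
noncomputable def orderStat {ι : Type*} (S : Finset ι) (a : ℕ) (f : ι → ℕ) : ℕ :=
  sInf {x | a ≤ (S.filter fun i => f i ≤ x).card}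

theorem orderStat_le_add {ι : Type*} (S : Finset ι) (a : ℕ) (f g : ι → ℕ) (d : ℕ)
    (h : ∀ i ∈ S, f i ≤ g i + d) : orderStat S a f ≤ orderStat S a g + d := by
  by_cases hg : {x | a ≤ (S.filter fun i => g i ≤ x).card}.Nonempty
  · refine Nat.sInf_le ?_
    have h1 : a ≤ (S.filter fun i => g i ≤ orderStat S a g).card := Nat.sInf_mem hg
    refine h1.trans (Finset.card_le_card fun i hi => ?_)
    rw [Finset.mem_filter] at hi ⊢
    have := h i hi.1
    exact ⟨hi.1, by omega⟩
  -- With fewer than `a` values both infima are over the empty set and equal 0.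
  · have hf : {x | a ≤ (S.filter fun i => f i ≤ x).card} = ∅ := by
      by_contra hne
      obtain ⟨x, hx⟩ := Set.nonempty_iff_ne_empty.2 hne
      refine hg ⟨S.sup g, ?_⟩
      have : (S.filter fun i => g i ≤ S.sup g) = S :=
        Finset.filter_true_of_mem fun i hi => Finset.le_sup hi
      rw [Set.mem_ofPred_eq, this]
      exact le_trans hx (Finset.card_filter_le _ _)
    simp [orderStat, hf]

/-- If an interval contains more than half of the values, it contains the median. -/
theorem orderStat_mem_of_card {ι : Type*} (S : Finset ι) (a : ℕ) (f : ι → ℕ) (v r : ℤ)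
    (hS : S.card < 2 * a) (h : a ≤ (S.filter fun i => |(f i : ℤ) - v| < r).card) :
    |(orderStat S a f : ℤ) - v| < r := by
  classical
  have ha : a ≠ 0 := by omega
  have hne : (S.filter fun i => |(f i : ℤ) - v| < r).Nonempty := by
    rw [← Finset.card_pos]; omega
  obtain ⟨i₀, hi₀⟩ := hne
  have hi₀' := abs_lt.1 (Finset.mem_filter.1 hi₀).2
  have hmem : a ≤ (S.filter fun i => f i ≤ (v + r - 1).toNat).card := by
    refine h.trans (Finset.card_le_card fun i hi => ?_)
    rw [Finset.mem_filter] at hi ⊢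
    have := abs_lt.1 hi.2
    exact ⟨hi.1, by omega⟩
  have hle : orderStat S a f ≤ (v + r - 1).toNat := Nat.sInf_le hmem
  have hat : a ≤ (S.filter fun i => f i ≤ orderStat S a f).card :=
    Nat.sInf_mem (s := {x | a ≤ (S.filter fun i => f i ≤ x).card}) ⟨_, hmem⟩
  rw [abs_lt]
  refine ⟨?_, by omega⟩
  by_contra hlt
  -- Otherwise there are `a` values below the interval and `a` values in it, more than `S` has.
  have hdisj : Disjoint (S.filter fun i => |(f i : ℤ) - v| < r)
      (S.filter fun i => f i ≤ orderStat S a f) := by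
    rw [Finset.disjoint_left]
    intro i hi hi'
    have h1 := abs_lt.1 (Finset.mem_filter.1 hi).2
    have h2 := (Finset.mem_filter.1 hi').2
    omega
  have hcard := Finset.card_union_of_disjoint hdisj
  have hsub : ((S.filter fun i => |(f i : ℤ) - v| < r) ∪
      (S.filter fun i => f i ≤ orderStat S a f)).card ≤ S.card :=
    Finset.card_le_card (Finset.union_subset (Finset.filter_subset _ _) (Finset.filter_subset _ _))
  omega

/-! ### Distances, walks and cells in the grid -/

/-- Two squares of the grid are at distance less than `r` in the maximum norm. -/
def GridNear {n : ℕ} (u v : Fin n × Fin n) (r : ℤ) : Prop :=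
  |(u.1 : ℤ) - v.1| < r ∧ |(u.2 : ℤ) - v.2| < r

open Classical in
/-- The number of cops at distance less than `r` from `v`. -/
noncomputable def copCount {n M : ℕ} (c : Fin M → Fin n × Fin n) (v : Fin n × Fin n) (r : ℤ) : ℕ :=
  (Finset.univ.filter fun i => GridNear (c i) v r).card

/-- The square `v` lies in the cell `(p, q)` of side `L`. -/
def InCell {n : ℕ} (L p q : ℤ) (v : Fin n × Fin n) : Prop :=
  p * L ≤ v.1 ∧ (v.1 : ℤ) < (p + 1) * L ∧ q * L ≤ v.2 ∧ (v.2 : ℤ) < (q + 1) * L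

/-- There are few cops around `v` on all scales below `i`. -/
def SafeBelow {n M : ℕ} (m i : ℕ) (c : Fin M → Fin n × Fin n) (v : Fin n × Fin n) : Prop :=
  ∀ j < i, copCount c v (20 * (10 ^ 4 * (m : ℤ) ^ j)) < 2 ^ j

theorem copCount_le_of_imp {n M : ℕ} {c c' : Fin M → Fin n × Fin n} {v v' : Fin n × Fin n}
    {r r' : ℤ} (h : ∀ i, GridNear (c i) v r → GridNear (c' i) v' r') :
    copCount c v r ≤ copCount c' v' r' := by
  classical
  refine Finset.card_le_card fun i hi => ?_
  simp only [Finset.mem_filter, Finset.mem_univ, true_and] at hi ⊢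
  exact h i hi

theorem gridGraph_adj_coord {n : ℕ} {u v : Fin n × Fin n} (h : u = v ∨ (gridGraph n).Adj v u) :
    |(u.1 : ℤ) - v.1| ≤ 1 ∧ |(u.2 : ℤ) - v.2| ≤ 1 := by
  rcases h with rfl | h
  · simp
  · rw [gridGraph, SimpleGraph.boxProd_adj, SimpleGraph.pathGraph_adj,
      SimpleGraph.pathGraph_adj] at h
    rw [abs_le, abs_le]
    rcases h with ⟨h, h'⟩ | ⟨h, h'⟩ <;> rw [h'] <;> omega

theorem exists_walk_snd {n : ℕ} (x : Fin n) (d : ℕ) (y y' : Fin n)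
    (hd : |(y' : ℤ) - y| ≤ d) : ∃ w : (gridGraph n).Walk (x, y) (x, y'), w.length ≤ d ∧
      ∀ z ∈ w.support, |(z.1 : ℤ) - x| ≤ 0 ∧ |(z.2 : ℤ) - y| ≤ d := by
  induction d generalizing y with
  | zero =>
    have : y = y' := by
      rw [abs_le] at hd
      exact Fin.ext (by omega)
    subst this
    exact ⟨.nil, by simp, by simp⟩
  | succ d ih =>
    by_cases h : |(y' : ℤ) - y| ≤ d
    · obtain ⟨w, h1, h2⟩ := ih y h
      refine ⟨w, by omega, fun z hz => ⟨(h2 z hz).1, ?_⟩⟩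
      have := (h2 z hz).2
      push_cast
      linarith
    · obtain ⟨y₁, hy₁, hy₁', hadj⟩ : ∃ y₁ : Fin n, |(y' : ℤ) - y₁| ≤ d ∧ |(y₁ : ℤ) - y| ≤ 1 ∧
          (gridGraph n).Adj (x, y) (x, y₁) := by
        simp only [abs_le, gridGraph, SimpleGraph.boxProd_adj, SimpleGraph.pathGraph_adj] at *
        by_cases hlt : (y : ℕ) < y'
        · exact ⟨⟨y + 1, by omega⟩, by simp; omega, by simp, by simp⟩
        · refine ⟨⟨y - 1, by omega⟩, ?_, ?_, ?_⟩ <;> simp <;> omega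
      obtain ⟨w, h1, h2⟩ := ih y₁ hy₁
      refine ⟨.cons hadj w, by simp; omega, fun z hz => ?_⟩
      rw [SimpleGraph.Walk.support_cons, List.mem_cons] at hz
      rcases hz with rfl | hz
      · simp; positivity
      · obtain ⟨h3, h4⟩ := h2 z hz
        refine ⟨h3, ?_⟩
        rw [abs_le] at *
        push_cast
        omega

theorem exists_walk_fst {n : ℕ} (y : Fin n) (d : ℕ) (x x' : Fin n)
    (hd : |(x' : ℤ) - x| ≤ d) : ∃ w : (gridGraph n).Walk (x, y) (x', y), w.length ≤ d ∧
      ∀ z ∈ w.support, |(z.1 : ℤ) - x| ≤ d ∧ |(z.2 : ℤ) - y| ≤ 0 := by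
  obtain ⟨w, h1, h2⟩ := exists_walk_snd y d x x' hd
  let e : gridGraph n →g gridGraph n := ⟨Prod.swap, by
    intro a b h
    simp only [gridGraph, SimpleGraph.boxProd_adj, Prod.fst_swap, Prod.snd_swap] at h ⊢
    exact h.symm⟩
  refine ⟨w.map e, by simpa using h1, fun z hz => ?_⟩
  rw [SimpleGraph.Walk.support_map, List.mem_map] at hz
  obtain ⟨z', hz', rfl⟩ := hz
  exact (h2 z' hz').symm

/-- An L-shaped walk from `u` to `v` stays within distance `d` of `u`. -/
theorem robberMove_of_near {n M R d : ℕ} (hR : 2 * d ≤ R) (c : Fin M → Fin n × Fin n)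
    (u v : Fin n × Fin n) (h1 : |(v.1 : ℤ) - u.1| ≤ d) (h2 : |(v.2 : ℤ) - u.2| ≤ d)
    (hc : ∀ i, ¬ GridNear (c i) u (d + 1)) : RobberMove (gridGraph n) R c u v := by
  obtain ⟨x, y⟩ := u
  obtain ⟨x', y'⟩ := v
  obtain ⟨w, hw, hw'⟩ := exists_walk_fst y d x x' h1
  obtain ⟨w₂, hw₂, hw₂'⟩ := exists_walk_snd x' d y y' h2
  refine ⟨w.append w₂, by rw [SimpleGraph.Walk.length_append]; omega, fun z hz i hi => hc i ?_⟩
  rw [SimpleGraph.Walk.mem_support_append_iff] at hz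
  subst hi
  simp only at h1
  rcases hz with hz | hz
  · obtain ⟨h3, h4⟩ := hw' _ hz
    exact ⟨by simp only; omega, by simp only; omega⟩
  · obtain ⟨h3, h4⟩ := hw₂' _ hz
    refine ⟨?_, by simp only; omega⟩
    have : ((c i).1 : ℤ) = x' := by rw [abs_le] at h3; omega
    simp only [this]
    omega

/-! ### Coordinates along a pair of adjacent cells -/

/-- Coordinates on a pair of adjacent cells `(p, q)` and `(p', q')` that are divided into `m × m`
subcells of side `L`: the subcell `(P X Y, Q X Y)` is the `X`-th in the direction from the first
cell to the second, and the `Y`-th in the transverse direction. -/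
structure CellFrame (m L p q p' q' : ℤ) where
  P : ℤ → ℤ → ℤ
  Q : ℤ → ℤ → ℤ
  fwd : ℤ → ℤ → ℤ
  trv : ℤ → ℤ → ℤ
  adj : ∀ X Y X' Y', |X' - X| + |Y' - Y| = 1 → |P X' Y' - P X Y| + |Q X' Y' - Q X Y| = 1
  row : ∀ X Y Y' d, |Y' - Y| ≤ d → |P X Y' - P X Y| ≤ d ∧ |Q X Y' - Q X Y| ≤ d
  lip : ∀ a b a' b' d, |a' - a| ≤ d → |b' - b| ≤ d →
    |fwd a' b' - fwd a b| ≤ d ∧ |trv a' b' - trv a b| ≤ d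
  far : ∀ X Y r x y a b, P X Y * L ≤ x → x < (P X Y + 1) * L → Q X Y * L ≤ y →
    y < (Q X Y + 1) * L → FarFromCell L r X Y (fwd a b) (trv a b) →
    ¬ (|a - x| < r * L ∧ |b - y| < r * L)
  range : ∀ X Y, 0 ≤ X → X < 2 * m → 0 ≤ Y → Y < m →
    (p * m ≤ P X Y ∧ P X Y < (p + 1) * m ∧ q * m ≤ Q X Y ∧ Q X Y < (q + 1) * m) ∨
    (p' * m ≤ P X Y ∧ P X Y < (p' + 1) * m ∧ q' * m ≤ Q X Y ∧ Q X Y < (q' + 1) * m)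
  target : ∀ X Y, m ≤ X → X < 2 * m → 0 ≤ Y → Y < m →
    p' * m ≤ P X Y ∧ P X Y < (p' + 1) * m ∧ q' * m ≤ Q X Y ∧ Q X Y < (q' + 1) * m
  start : ∀ a b, p * m ≤ a → a < (p + 1) * m → q * m ≤ b → b < (q + 1) * m →
    ∃ X Y, 0 ≤ X ∧ X < m ∧ 0 ≤ Y ∧ Y < m ∧ P X Y = a ∧ Q X Y = b

/-- The `a + 1` allows for reflected coordinates `a ↦ N - 1 - a`; the lost unit is regained because
`x < (P + 1) * L` is strict between integers. -/
theorem not_near_of_far_aux {L r P x a : ℤ} (h1 : P * L ≤ x) (h2 : x < (P + 1) * L)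
    (h : a ≤ (P - r) * L ∨ (P + 1 + r) * L ≤ a + 1) : ¬ |a - x| < r * L := by
  rw [abs_lt]
  rintro ⟨h3, h4⟩
  rcases h with h | h <;> nlinarith

theorem CellFrame.nonempty (m L p q p' q' : ℤ) (h : |p' - p| + |q' - q| = 1) :
    Nonempty (CellFrame m L p q p' q') := by
  have key : (p' = p + 1 ∧ q' = q) ∨ (p' = p - 1 ∧ q' = q) ∨ (p' = p ∧ q' = q + 1) ∨
      (p' = p ∧ q' = q - 1) := by
    rcases abs_cases (p' - p) with ⟨h1, h2⟩ | ⟨h1, h2⟩ <;>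
    rcases abs_cases (q' - q) with ⟨h3, h4⟩ | ⟨h3, h4⟩ <;> omega
  rcases key with ⟨rfl, rfl⟩ | ⟨rfl, rfl⟩ | ⟨rfl, rfl⟩ | ⟨rfl, rfl⟩
  · refine ⟨⟨fun X _ => p * m + X, fun _ Y => q' * m + Y, fun a _ => a - p * m * L,
      fun _ b => b - q' * m * L, ?_, ?_, ?_, ?_, ?_, ?_, ?_⟩⟩
    · intro X Y X' Y' h
      simpa using h
    · intro X Y Y' d h
      simpa using ⟨(abs_nonneg _).trans h, h⟩
    · intro a b a' b' d h h'
      simpa using ⟨h, h'⟩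
    · rintro X Y r x y a b h1 h2 h3 h4 h ⟨h5, h6⟩
      rcases h with h | h | h | h
      · exact not_near_of_far_aux h1 h2 (.inl (by linarith)) h5
      · exact not_near_of_far_aux h1 h2 (.inr (by linarith)) h5
      · exact not_near_of_far_aux h3 h4 (.inl (by linarith)) h6
      · exact not_near_of_far_aux h3 h4 (.inr (by linarith)) h6
    · intro X Y h1 h2 h3 h4
      by_cases hX : X < m
      · left; refine ⟨?_, ?_, ?_, ?_⟩ <;> linarith
      · right; refine ⟨?_, ?_, ?_, ?_⟩ <;> linarith
    · intro X Y h1 h2 h3 h4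
      refine ⟨?_, ?_, ?_, ?_⟩ <;> linarith
    · intro a b h1 h2 h3 h4
      exact ⟨a - p * m, b - q' * m, by linarith, by linarith, by linarith, by linarith, by ring,
        by ring⟩
  · refine ⟨⟨fun X _ => (p + 1) * m - 1 - X, fun _ Y => q' * m + Y,
      fun a _ => (p + 1) * m * L - 1 - a, fun _ b => b - q' * m * L, ?_, ?_, ?_, ?_, ?_, ?_, ?_⟩⟩
    · intro X Y X' Y' h
      rw [← h, abs_sub_comm X' X]
      ring_nf
    · intro X Y Y' d h
      simpa using ⟨(abs_nonneg _).trans h, h⟩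
    · intro a b a' b' d h h'
      rw [abs_sub_comm] at h
      ring_nf at h h' ⊢
      exact ⟨h, h'⟩
    · rintro X Y r x y a b h1 h2 h3 h4 h ⟨h5, h6⟩
      rcases h with h | h | h | h
      · exact not_near_of_far_aux h1 h2 (.inr (by linarith)) h5
      · exact not_near_of_far_aux h1 h2 (.inl (by linarith)) h5
      · exact not_near_of_far_aux h3 h4 (.inl (by linarith)) h6
      · exact not_near_of_far_aux h3 h4 (.inr (by linarith)) h6
    · intro X Y h1 h2 h3 h4
      by_cases hX : X < m
      · left; refine ⟨?_, ?_, ?_, ?_⟩ <;> linarith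
      · right; refine ⟨?_, ?_, ?_, ?_⟩ <;> linarith
    · intro X Y h1 h2 h3 h4
      refine ⟨?_, ?_, ?_, ?_⟩ <;> linarith
    · intro a b h1 h2 h3 h4
      exact ⟨(p + 1) * m - 1 - a, b - q' * m, by linarith, by linarith, by linarith, by linarith,
        by ring, by ring⟩
  · refine ⟨⟨fun _ Y => p' * m + Y, fun X _ => q * m + X, fun _ b => b - q * m * L,
      fun a _ => a - p' * m * L, ?_, ?_, ?_, ?_, ?_, ?_, ?_⟩⟩
    · intro X Y X' Y' h
      rw [add_comm] at h
      simpa using h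
    · intro X Y Y' d h
      simpa using ⟨h, (abs_nonneg _).trans h⟩
    · intro a b a' b' d h h'
      simpa using ⟨h', h⟩
    · rintro X Y r x y a b h1 h2 h3 h4 h ⟨h5, h6⟩
      rcases h with h | h | h | h
      · exact not_near_of_far_aux h3 h4 (.inl (by linarith)) h6
      · exact not_near_of_far_aux h3 h4 (.inr (by linarith)) h6
      · exact not_near_of_far_aux h1 h2 (.inl (by linarith)) h5
      · exact not_near_of_far_aux h1 h2 (.inr (by linarith)) h5
    · intro X Y h1 h2 h3 h4
      by_cases hX : X < m
      · left; refine ⟨?_, ?_, ?_, ?_⟩ <;> linarith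
      · right; refine ⟨?_, ?_, ?_, ?_⟩ <;> linarith
    · intro X Y h1 h2 h3 h4
      refine ⟨?_, ?_, ?_, ?_⟩ <;> linarith
    · intro a b h1 h2 h3 h4
      exact ⟨b - q * m, a - p' * m, by linarith, by linarith, by linarith, by linarith, by ring,
        by ring⟩
  · refine ⟨⟨fun _ Y => p' * m + Y, fun X _ => (q + 1) * m - 1 - X,
      fun _ b => (q + 1) * m * L - 1 - b, fun a _ => a - p' * m * L, ?_, ?_, ?_, ?_, ?_, ?_, ?_⟩⟩
    · intro X Y X' Y' h
      rw [← h, abs_sub_comm X' X]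
      ring_nf
    · intro X Y Y' d h
      simpa using ⟨h, (abs_nonneg _).trans h⟩
    · intro a b a' b' d h h'
      rw [abs_sub_comm] at h'
      ring_nf at h h' ⊢
      exact ⟨h', h⟩
    · rintro X Y r x y a b h1 h2 h3 h4 h ⟨h5, h6⟩
      rcases h with h | h | h | h
      · exact not_near_of_far_aux h3 h4 (.inr (by linarith)) h6
      · exact not_near_of_far_aux h3 h4 (.inl (by linarith)) h6
      · exact not_near_of_far_aux h1 h2 (.inl (by linarith)) h5
      · exact not_near_of_far_aux h1 h2 (.inr (by linarith)) h5
    · intro X Y h1 h2 h3 h4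
      by_cases hX : X < m
      · left; refine ⟨?_, ?_, ?_, ?_⟩ <;> linarith
      · right; refine ⟨?_, ?_, ?_, ?_⟩ <;> linarith
    · intro X Y h1 h2 h3 h4
      refine ⟨?_, ?_, ?_, ?_⟩ <;> linarith
    · intro a b h1 h2 h3 h4
      exact ⟨(q + 1) * m - 1 - b, a - p' * m, by linarith, by linarith, by linarith, by linarith,
        by ring, by ring⟩

theorem inCell_of_subcell {n : ℕ} {m L p q a b : ℤ} {v : Fin n × Fin n} (hL : 0 ≤ L)
    (h : p * m ≤ a ∧ a < (p + 1) * m ∧ q * m ≤ b ∧ b < (q + 1) * m) (hv : InCell L a b v) :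
    InCell (m * L) p q v := by
  obtain ⟨h1, h2, h3, h4⟩ := h
  obtain ⟨h5, h6, h7, h8⟩ := hv
  have h2' : a + 1 ≤ (p + 1) * m := h2
  have h4' : b + 1 ≤ (q + 1) * m := h4
  have e1 := mul_le_mul_of_nonneg_right h1 hL
  have e2 := mul_le_mul_of_nonneg_right h2' hL
  have e3 := mul_le_mul_of_nonneg_right h3 hL
  have e4 := mul_le_mul_of_nonneg_right h4' hL
  refine ⟨?_, ?_, ?_, ?_⟩ <;> linarith

theorem exists_subcell {n : ℕ} {m L p q : ℤ} {v : Fin n × Fin n} (hL : 0 < L)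
    (hv : InCell (m * L) p q v) : ∃ a b, p * m ≤ a ∧ a < (p + 1) * m ∧ q * m ≤ b ∧
      b < (q + 1) * m ∧ InCell L a b v := by
  obtain ⟨h1, h2, h3, h4⟩ := hv
  refine ⟨v.1 / L, v.2 / L, ?_, ?_, ?_, ?_, Int.ediv_mul_le _ hL.ne',
    Int.lt_ediv_add_one_mul_self _ hL, Int.ediv_mul_le _ hL.ne', Int.lt_ediv_add_one_mul_self _ hL⟩
  · rw [Int.le_ediv_iff_mul_le hL]; linarith
  · rw [Int.ediv_lt_iff_lt_mul hL]; linarith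
  · rw [Int.le_ediv_iff_mul_le hL]; linarith
  · rw [Int.ediv_lt_iff_lt_mul hL]; linarith

/-- Squares in cells at distance at most `d` differ by less than `(d + 1) * L` in each coordinate. -/
theorem abs_sub_lt_of_cells {L a a' x x' d : ℤ} (hL : 0 ≤ L) (h1 : a * L ≤ x)
    (h2 : x < (a + 1) * L) (h3 : a' * L ≤ x') (h4 : x' < (a' + 1) * L) (h : |a' - a| ≤ d) :
    |x' - x| < (d + 1) * L := by
  obtain ⟨h5, h6⟩ := abs_le.1 h
  rw [abs_lt]
  constructor <;> nlinarith

/-! ### Induction on scales -/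

/-- Points of adjacent cells differ by at most 20000 in each coordinate, hence the speed 40000. Cops
at distance at least `3 * 10 ^ 4` are still out of the way after their one move. -/
theorem cell_step_zero {n M R : ℕ} (hR : 40000 ≤ R) (m : ℕ) (s : GameState (Fin n × Fin n) M)
    (p q p' q' : ℤ) (hadj : |p' - p| + |q' - q| = 1) (hp' : 0 ≤ p') (hq' : 0 ≤ q')
    (hpn : (p' + 1) * 10 ^ 4 ≤ n) (hqn : (q' + 1) * 10 ^ 4 ≤ n) (hv : InCell (10 ^ 4) p q s.robber)
    (hcount : copCount s.cops s.robber (3 * 10 ^ 4) < 1) :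
    RobberForces (gridGraph n) R (fun s' => (s'.time : ℤ) ≤ s.time + 1 ∧
      InCell (10 ^ 4) p' q' s'.robber ∧ SafeBelow m 0 s'.cops s'.robber) s := by
  have hno : ∀ i, ¬ GridNear (s.cops i) s.robber (3 * 10 ^ 4) := by
    classical
    intro i hi
    have : copCount s.cops s.robber (3 * 10 ^ 4) = 0 := by omega
    rw [copCount, Finset.card_eq_zero] at this
    exact Finset.notMem_empty i (this ▸ Finset.mem_filter.2 ⟨Finset.mem_univ i, hi⟩)
  obtain ⟨h1, h2, h3, h4⟩ := hv
  let v' : Fin n × Fin n := (⟨(p' * 10 ^ 4).toNat, by omega⟩, ⟨(q' * 10 ^ 4).toNat, by omega⟩)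
  have hx : (v'.1 : ℤ) = p' * 10 ^ 4 := by simp [v']; omega
  have hy : (v'.2 : ℤ) = q' * 10 ^ 4 := by simp [v']; omega
  have hpp : |p' - p| ≤ 1 := by linarith [abs_nonneg (q' - q)]
  have hqq : |q' - q| ≤ 1 := by linarith [abs_nonneg (p' - p)]
  rw [abs_le] at hpp hqq
  refine .step s (fun _ => v') (fun c' hc' => ?_) (fun c' hc' => .done _ ⟨by simp, ?_, ?_⟩)
  · refine robberMove_of_near (d := 20000) (by omega) c' _ _ ?_ ?_ ?_
    · rw [hx, abs_le]; omega
    · rw [hy, abs_le]; omega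
    · rintro i ⟨hi1, hi2⟩
      obtain ⟨hc1, hc2⟩ := gridGraph_adj_coord (hc' i)
      refine hno i ⟨?_, ?_⟩
      · rw [abs_lt] at *
        rw [abs_le] at hc1
        push_cast at *
        omega
      · rw [abs_lt] at *
        rw [abs_le] at hc2
        push_cast at *
        omega
  · simp only [InCell, hx, hy]
    omega
  · intro j hj
    omega

theorem abs_orderStat_sub_le {n M : ℕ} (S : Finset (Fin M)) (a : ℕ)
    (g : Fin n × Fin n → ℕ) (hg : ∀ u v, (u = v ∨ (gridGraph n).Adj v u) →
      |(g u : ℤ) - g v| ≤ 1) (c c' : Fin M → Fin n × Fin n) (h : CopMove (gridGraph n) c c') :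
    |(orderStat S a (fun i => g (c' i)) : ℤ) - orderStat S a (fun i => g (c i))| ≤ 1 := by
  have h1 := orderStat_le_add S a (fun i => g (c' i)) (fun i => g (c i)) 1 fun i _ => by
    have := (abs_le.1 (hg _ _ (h i))).2
    omega
  have h2 := orderStat_le_add S a (fun i => g (c i)) (fun i => g (c' i)) 1 fun i _ => by
    have := (abs_le.1 (hg _ _ (h i))).1
    omega
  rw [abs_le]
  omega

/-- The robber can move between adjacent cells, side `10 ^ 4 * m ^ i`, in time `(m + 57) ^ i`, if
there are few cops around his cell, and returns to a position that is safe on all smaller scales. -/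
def CellStep (n M R m i : ℕ) : Prop :=
  ∀ (s : GameState (Fin n × Fin n) M) (p q p' q' : ℤ), |p' - p| + |q' - q| = 1 →
    0 ≤ p → 0 ≤ q → 0 ≤ p' → 0 ≤ q' →
    (p + 1) * (10 ^ 4 * (m : ℤ) ^ i) ≤ n → (q + 1) * (10 ^ 4 * (m : ℤ) ^ i) ≤ n →
    (p' + 1) * (10 ^ 4 * (m : ℤ) ^ i) ≤ n → (q' + 1) * (10 ^ 4 * (m : ℤ) ^ i) ≤ n →
    InCell (10 ^ 4 * (m : ℤ) ^ i) p q s.robber → SafeBelow m i s.cops s.robber →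
    copCount s.cops s.robber (3 * (10 ^ 4 * (m : ℤ) ^ i)) < 2 ^ i →
    RobberForces (gridGraph n) R (fun s' => (s'.time : ℤ) ≤ s.time + ((m : ℤ) + 57) ^ i ∧
      InCell (10 ^ 4 * (m : ℤ) ^ i) p' q' s'.robber ∧ SafeBelow m i s'.cops s'.robber) s

theorem cell_step_succ {n M R m i : ℕ} (hm : 60 ≤ m)
    (hT : 1000 * ((m : ℤ) + 57) ^ i ≤ 10 ^ 4 * (m : ℤ) ^ i)
    (hT' : 1000 * ((m : ℤ) + 57) ^ (i + 1) ≤ 10 ^ 4 * (m : ℤ) ^ (i + 1))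
    (ih : CellStep n M R m i) : CellStep n M R m (i + 1) := by
  classical
  rintro s₀ p q p' q' hadj hp hq hp' hq' hpn hqn hpn' hqn' hv hsafe hcount
  have hm' : (60 : ℤ) ≤ m := by exact_mod_cast hm
  set L : ℤ := 10 ^ 4 * (m : ℤ) ^ i with hLdef
  set τ : ℤ := ((m : ℤ) + 57) ^ i with hτdef
  have hLpos : 0 < L := by positivity
  have hτ0 : 0 ≤ τ := by positivity
  have hLL : 10 ^ 4 * (m : ℤ) ^ (i + 1) = m * L := by rw [hLdef]; ring
  have hττ : ((m : ℤ) + 57) ^ (i + 1) = (m + 57) * τ := by rw [hτdef]; ring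
  rw [hLL] at hpn hqn hpn' hqn' hv hcount hT' ⊢
  rw [hττ] at hT' ⊢
  have hmL : 60 * L ≤ m * L := mul_le_mul_of_nonneg_right hm' hLpos.le
  obtain ⟨F⟩ := CellFrame.nonempty m L p q p' q' hadj
  -- The set is fixed once, at the initial position, so that its median moves slowly. If it has
  -- fewer than `2 ^ i` members, the median is the default 0, but then nothing can obstruct the
  -- robber.
  set S : Finset (Fin M) := Finset.univ.filter fun j => GridNear (s₀.cops j) s₀.robber (3 * (m * L))
    with hSdef
  have hS : S.card < 2 * 2 ^ i := by
    rw [← pow_succ']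
    exact hcount
  set b₁ : (Fin M → Fin n × Fin n) → ℕ := fun c => orderStat S (2 ^ i) fun j => (c j).1 with hb₁
  set b₂ : (Fin M → Fin n × Fin n) → ℕ := fun c => orderStat S (2 ^ i) fun j => (c j).2 with hb₂
  have hb₁lip : ∀ c c', CopMove (gridGraph n) c c' → |(b₁ c' : ℤ) - b₁ c| ≤ 1 :=
    abs_orderStat_sub_le S (2 ^ i) (fun u => u.1) fun u v h => (gridGraph_adj_coord h).1
  have hb₂lip : ∀ c c', CopMove (gridGraph n) c c' → |(b₂ c' : ℤ) - b₂ c| ≤ 1 :=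
    abs_orderStat_sub_le S (2 ^ i) (fun u => u.2) fun u v h => (gridGraph_adj_coord h).2
  set Inv : GameState (Fin n × Fin n) M → Prop := fun s =>
    SafeBelow m i s.cops s.robber ∧ ∀ j,
      |((s.cops j).1 : ℤ) - (s₀.cops j).1| ≤ s.time - s₀.time ∧
      |((s.cops j).2 : ℤ) - (s₀.cops j).2| ≤ s.time - s₀.time with hInvdef
  have hbig : ∀ (s : GameState (Fin n × Fin n) M) (X Y : ℤ), 0 ≤ X → X < 2 * (m : ℤ) → 0 ≤ Y → Y < m →
      InCell L (F.P X Y) (F.Q X Y) s.robber →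
      |(s.robber.1 : ℤ) - s₀.robber.1| < (1 + 1) * (m * L) ∧
      |(s.robber.2 : ℤ) - s₀.robber.2| < (1 + 1) * (m * L) := by
    intro s X Y h1 h2 h3 h4 hc
    have hpp : |p' - p| ≤ 1 := by linarith [abs_nonneg (q' - q)]
    have hqq : |q' - q| ≤ 1 := by linarith [abs_nonneg (p' - p)]
    have hmL0 : 0 ≤ (m : ℤ) * L := by linarith
    obtain ⟨a1, a2, a3, a4⟩ := hv
    rcases F.range X Y h1 h2 h3 h4 with h | h
    · obtain ⟨c1, c2, c3, c4⟩ := inCell_of_subcell hLpos.le h hc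
      exact ⟨abs_sub_lt_of_cells hmL0 a1 a2 c1 c2 (by simp),
        abs_sub_lt_of_cells hmL0 a3 a4 c3 c4 (by simp)⟩
    · obtain ⟨c1, c2, c3, c4⟩ := inCell_of_subcell hLpos.le h hc
      exact ⟨abs_sub_lt_of_cells hmL0 a1 a2 c1 c2 hpp,
        abs_sub_lt_of_cells hmL0 a3 a4 c3 c4 hqq⟩
  have hlight : ∀ (s : GameState (Fin n × Fin n) M) X Y r, Inv s →
      InCell L (F.P X Y) (F.Q X Y) s.robber → 0 ≤ X → X < 2 * (m : ℤ) → 0 ≤ Y → Y < m →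
      (s.time : ℤ) ≤ s₀.time + (m + 57) * τ → r ≤ 20 →
      FarFromCell L r X Y (F.fwd (b₁ s.cops) (b₂ s.cops)) (F.trv (b₁ s.cops) (b₂ s.cops)) →
      copCount s.cops s.robber (r * L) < 2 ^ i := by
    intro s X Y r hi hc h1 h2 h3 h4 ht hr hf
    by_contra! hge
    obtain ⟨g1, g2⟩ := hbig s X Y h1 h2 h3 h4 hc
    have hrL : r * L ≤ 20 * L := mul_le_mul_of_nonneg_right hr hLpos.le
    -- The robber has moved by less than `2 * (m * L)` and each cop by at most `m * L / 1000`; with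
    -- `20 * L ≤ m * L / 3` this stays below the radius `3 * (m * L)` of `S`.
    have hin : ∀ j, GridNear (s.cops j) s.robber (r * L) → j ∈ S := by
      rintro j ⟨n1, n2⟩
      obtain ⟨d1, d2⟩ := hi.2 j
      refine Finset.mem_filter.2 ⟨Finset.mem_univ _, ?_, ?_⟩
      · rw [abs_lt] at *
        rw [abs_le] at d1
        constructor <;> linarith
      · rw [abs_lt] at *
        rw [abs_le] at d2
        constructor <;> linarith
    refine F.far X Y r _ _ _ _ hc.1 hc.2.1 hc.2.2.1 hc.2.2.2 hf ⟨?_, ?_⟩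
    · refine orderStat_mem_of_card S (2 ^ i) _ _ _ hS (hge.trans (Finset.card_le_card fun j hj => ?_))
      have hj' := (Finset.mem_filter.1 hj).2
      exact Finset.mem_filter.2 ⟨hin j hj', hj'.1⟩
    · refine orderStat_mem_of_card S (2 ^ i) _ _ _ hS (hge.trans (Finset.card_le_card fun j hj => ?_))
      have hj' := (Finset.mem_filter.1 hj).2
      exact Finset.mem_filter.2 ⟨hin j hj', hj'.2⟩
  obtain ⟨a, b, ha, ha', hb, hb', hab⟩ := exists_subcell hLpos hv
  obtain ⟨X₀, Y₀, hX₀, hX₀', hY₀, hY₀', rfl, rfl⟩ := F.start a b ha ha' hb hb'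
  have hgrid : ∀ X Y : ℤ, 0 ≤ X → X < 2 * (m : ℤ) → 0 ≤ Y → Y < m →
      0 ≤ F.P X Y ∧ 0 ≤ F.Q X Y ∧ (F.P X Y + 1) * L ≤ n ∧ (F.Q X Y + 1) * L ≤ n := by
    intro X Y h1 h2 h3 h4
    have aux : ∀ P t : ℤ, 0 ≤ t → (t + 1) * (m * L) ≤ n → t * m ≤ P → P < (t + 1) * m →
        0 ≤ P ∧ (P + 1) * L ≤ n := by
      intro P t ht htn h h'
      have h'' : P + 1 ≤ (t + 1) * m := h'
      have := mul_le_mul_of_nonneg_right h'' hLpos.le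
      have := mul_nonneg ht (by positivity : (0 : ℤ) ≤ m)
      exact ⟨by linarith, by linarith⟩
    rcases F.range X Y h1 h2 h3 h4 with ⟨c1, c2, c3, c4⟩ | ⟨c1, c2, c3, c4⟩
    · exact ⟨(aux _ _ hp hpn c1 c2).1, (aux _ _ hq hqn c3 c4).1, (aux _ _ hp hpn c1 c2).2,
        (aux _ _ hq hqn c3 c4).2⟩
    · exact ⟨(aux _ _ hp' hpn' c1 c2).1, (aux _ _ hq' hqn' c3 c4).1, (aux _ _ hp' hpn' c1 c2).2,
        (aux _ _ hq' hqn' c3 c4).2⟩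
  refine (dodge (m : ℤ) L τ s₀.time hm' hτ0 hT
    (fun s => F.fwd (b₁ s.cops) (b₂ s.cops)) (fun s => F.trv (b₁ s.cops) (b₂ s.cops))
    (fun X Y s => InCell L (F.P X Y) (F.Q X Y) s.robber) Inv
    (fun s => copCount s.cops s.robber (3 * L) < 2 ^ i) ?_ ?_ s₀ X₀ Y₀ hX₀ hX₀' hY₀ hY₀'
    ⟨fun j hj => hsafe j (by omega), by simp⟩ hab le_rfl ?_).mono ?_
  · intro s X Y X' Y' hi hc hl h1 h2 h3 h4 h5 h6 h7 h8 hXY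
    obtain ⟨e1, e2, e3, e4⟩ := hgrid X Y h1 h2 h3 h4
    obtain ⟨e5, e6, e7, e8⟩ := hgrid X' Y' h5 h6 h7 h8
    refine (ih s _ _ _ _ (F.adj X Y X' Y' hXY) e1 e2 e5 e6 e3 e4 e7 e8 hc hi.1 hl).with_drift.mono ?_
    rintro s' ⟨⟨ht, hc', hs'⟩, -, hdrift⟩
    have hd₁ := hdrift (fun c => (b₁ c : ℤ)) hb₁lip
    have hd₂ := hdrift (fun c => (b₂ c : ℤ)) hb₂lip
    have ht' : (s'.time : ℤ) - s.time ≤ τ := by linarith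
    refine ⟨⟨hs', fun j => ?_⟩, hc', ht, F.lip _ _ _ _ _ (hd₁.trans ht') (hd₂.trans ht')⟩
    have k₁ := hdrift (fun c => ((c j).1 : ℤ)) fun c c' h => (gridGraph_adj_coord (h j)).1
    have k₂ := hdrift (fun c => ((c j).2 : ℤ)) fun c c' h => (gridGraph_adj_coord (h j)).2
    obtain ⟨l₁, l₂⟩ := hi.2 j
    simp only [abs_le] at *
    refine ⟨⟨?_, ?_⟩, ?_, ?_⟩ <;> linarith
  · intro s X Y hi hc h1 h2 h3 h4 ht hf
    exact hlight s X Y 3 hi hc h1 h2 h3 h4 ht (by norm_num) hf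
  · intro s Y hi hc hY ht
    -- Level `i` safety at the start has radius `20 * L`: it covers a displacement below `13 * L`,
    -- the radius `3 * L` and the drift `12 * τ`.
    refine lt_of_le_of_lt (copCount_le_of_imp fun j hj => ?_) (hsafe i (Nat.lt_succ_self i))
    rw [← hLdef]
    obtain ⟨r1, r2⟩ := F.row X₀ Y₀ Y 12 hY
    have n1 := abs_sub_lt_of_cells hLpos.le hab.1 hab.2.1 hc.1 hc.2.1 r1
    have n2 := abs_sub_lt_of_cells hLpos.le hab.2.2.1 hab.2.2.2 hc.2.2.1 hc.2.2.2 r2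
    obtain ⟨d1, d2⟩ := hi.2 j
    obtain ⟨j1, j2⟩ := hj
    constructor
    · rw [abs_lt] at *
      rw [abs_le] at d1
      constructor <;> linarith
    · rw [abs_lt] at *
      rw [abs_le] at d2
      constructor <;> linarith
  · rintro s ⟨hi, ht, X, Y, h1, h2, h3, h4, hc, hf⟩
    refine ⟨ht, inCell_of_subcell hLpos.le (F.target X Y h1 h2 h3 h4) hc, fun j hj => ?_⟩
    rcases Nat.lt_succ_iff_lt_or_eq.1 hj with hj | rfl
    · exact hi.1 j hj
    -- Ending 20 cells away from the median restores safety on level `i`, as the next move requires.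
    · exact hlight s X Y 20 hi hc (by linarith) h2 h3 h4 ht le_rfl hf

theorem cellStep {n M R m : ℕ} (hR : 40000 ≤ R) (hm : 60 ≤ m) (k : ℕ)
    (hT : ∀ i ≤ k, 1000 * ((m : ℤ) + 57) ^ i ≤ 10 ^ 4 * (m : ℤ) ^ i) : CellStep n M R m k := by
  induction k with
  | zero =>
    rintro s p q p' q' hadj - - hp' hq' - - hpn' hqn' hv - hcount
    simp only [pow_zero, mul_one] at *
    exact cell_step_zero hR m s p q p' q' hadj hp' hq' hpn' hqn' hv hcount
  | succ k ih =>
    exact cell_step_succ hm (hT k (by omega)) (hT (k + 1) le_rfl) (ih fun i hi => hT i (by omega))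

/-- A cell of level `i` with few cops contains a square that is safe on all smaller scales. -/
theorem exists_safe {n M m : ℕ} (hm : 60 ≤ m) (c : Fin M → Fin n × Fin n) (i : ℕ) (p q : ℤ)
    (hp : 0 ≤ p) (hq : 0 ≤ q) (hpn : (p + 1) * (10 ^ 4 * (m : ℤ) ^ i) ≤ n)
    (hqn : (q + 1) * (10 ^ 4 * (m : ℤ) ^ i) ≤ n)
    (hcount : ∀ v, InCell (10 ^ 4 * (m : ℤ) ^ i) p q v →
      copCount c v (3 * (10 ^ 4 * (m : ℤ) ^ i)) < 2 ^ i) :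
    ∃ v, InCell (10 ^ 4 * (m : ℤ) ^ i) p q v ∧ SafeBelow m i c v := by
  classical
  induction i generalizing p q with
  | zero =>
    simp only [pow_zero, mul_one] at *
    refine ⟨(⟨(p * 10 ^ 4).toNat, by omega⟩, ⟨(q * 10 ^ 4).toNat, by omega⟩), ?_,
      fun j hj => by omega⟩
    simp only [InCell]
    omega
  | succ i ih =>
    have hm' : (60 : ℤ) ≤ m := by exact_mod_cast hm
    set L : ℤ := 10 ^ 4 * (m : ℤ) ^ i with hLdef
    have hLpos : 0 < L := by positivity
    have hLL : 10 ^ 4 * (m : ℤ) ^ (i + 1) = m * L := by rw [hLdef]; ring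
    rw [hLL] at hpn hqn hcount ⊢
    have hmL : 60 * L ≤ m * L := mul_le_mul_of_nonneg_right hm' hLpos.le
    have hpm : 0 ≤ p * m := by positivity
    have hqm : 0 ≤ q * m := by positivity
    have sub : ∀ P : ℤ, p * m ≤ P → P < (p + 1) * m →
        (∀ v, InCell L P (q * m) v → copCount c v (20 * L) < 2 ^ i) →
        ∃ v, InCell (m * L) p q v ∧ SafeBelow m (i + 1) c v := by
      intro P h1 h2 h
      have h2' : P + 1 ≤ (p + 1) * m := h2
      obtain ⟨v, hv, hs⟩ := ih P (q * m) (by linarith) hqm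
        (by linarith [mul_le_mul_of_nonneg_right h2' hLpos.le]) (by linarith)
        fun v hv => lt_of_le_of_lt (copCount_le_of_imp fun j hj =>
          ⟨by linarith [hj.1], by linarith [hj.2]⟩) (h v hv)
      refine ⟨v, inCell_of_subcell hLpos.le ⟨h1, h2, le_rfl, by linarith⟩ hv, fun j hj => ?_⟩
      rcases Nat.lt_succ_iff_lt_or_eq.1 hj with hj | rfl
      · exact hs j hj
      · exact h v hv
    by_contra hcon
    have bad : ∀ P : ℤ, p * m ≤ P → P < (p + 1) * m →
        ∃ v, InCell L P (q * m) v ∧ 2 ^ i ≤ copCount c v (20 * L) := by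
      intro P h1 h2
      by_contra! h
      exact hcon (sub P h1 h2 h)
    -- The first and last subcells of the bottom row are so far apart that their crowds are
    -- disjoint; together they would be `2 ^ (i + 1)` cops near `v`.
    obtain ⟨v, hv, hvc⟩ := bad (p * m) le_rfl (by linarith)
    obtain ⟨w, hw, hwc⟩ := bad ((p + 1) * m - 1) (by linarith) (by linarith)
    have hvbig := inCell_of_subcell hLpos.le (p := p) (q := q) (m := m)
      ⟨le_rfl, by linarith, le_rfl, by linarith⟩ hv
    obtain ⟨v1, v2, v3, v4⟩ := hv
    obtain ⟨w1, w2, w3, w4⟩ := hw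
    have hdisj : Disjoint (Finset.univ.filter fun j => GridNear (c j) v (20 * L))
        (Finset.univ.filter fun j => GridNear (c j) w (20 * L)) := by
      rw [Finset.disjoint_left]
      intro j hj hj'
      have h1 := abs_lt.1 (Finset.mem_filter.1 hj).2.1
      have h2 := abs_lt.1 (Finset.mem_filter.1 hj').2.1
      linarith
    have hsub : (Finset.univ.filter fun j => GridNear (c j) v (20 * L)) ∪
        (Finset.univ.filter fun j => GridNear (c j) w (20 * L)) ⊆
        Finset.univ.filter fun j => GridNear (c j) v (3 * (m * L)) := by
      intro j hj
      rw [Finset.mem_union, Finset.mem_filter, Finset.mem_filter] at hj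
      refine Finset.mem_filter.2 ⟨Finset.mem_univ _, ?_⟩
      rcases hj with ⟨-, h1, h2⟩ | ⟨-, h1, h2⟩
      · exact ⟨by linarith, by linarith⟩
      · rw [abs_lt] at h1 h2
        constructor
        · rw [abs_lt]
          constructor <;> linarith
        · rw [abs_lt]
          constructor <;> linarith
    have hle := Finset.card_le_card hsub
    rw [Finset.card_union_of_disjoint hdisj] at hle
    have := hcount v hvbig
    rw [pow_succ] at this
    simp only [copCount] at *
    omega

/-! ### From forced positions to a lower bound on the number of cops -/

/-- A set of positions, in each of which the robber can answer every move of the cops. -/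
theorem not_winning_of_invariant {V : Type*} {G : SimpleGraph V} {R M : ℕ}
    (W : (Fin M → V) → V → Prop)
    (hstart : ∀ c, ∃ v, (∀ i, c i ≠ v) ∧ W c v)
    (hW : ∀ c v, W c v → ∀ c', CopMove G c c' → ∃ v', RobberMove G R c' v v' ∧ W c' v')
    (σ : CopStrategy G M) : ¬ σ.Winning R := by
  intro hwin
  obtain ⟨v₀, hv₀, hWv₀⟩ := hstart (σ.pos [])
  have hlegal : ∀ (h : List V) (v : V), CopMove G (σ.pos h) (σ.pos (h ++ [v])) :=
    fun h v i => σ.step h v i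
  choose! f hf using hW
  let next : List V × V → List V × V := fun x =>
    (x.1 ++ [x.2], f (σ.pos x.1) x.2 (σ.pos (x.1 ++ [x.2])))
  let a : ℕ → List V × V := fun t => next^[t] ([], v₀)
  have ha : ∀ t, a (t + 1) = next (a t) := fun t => Function.iterate_succ_apply' _ _ _
  have haW : ∀ t, W (σ.pos (a t).1) (a t).2 := by
    intro t
    induction t with
    | zero => exact hWv₀
    | succ t ih =>
      rw [ha]
      exact (hf _ _ ih _ (hlegal _ _)).2
  let r : ℕ → V := fun t => (a t).2
  have hr : ∀ t, (a t).1 = (List.range t).map r := by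
    intro t
    induction t with
    | zero => rfl
    | succ t ih => rw [ha, List.range_succ, List.map_append, ← ih]; rfl
  have hmove : ∀ t, RobberMove G R (σ.cops r (t + 1)) (r t) (r (t + 1)) := by
    intro t
    have h := (hf _ _ (haW t) _ (hlegal (a t).1 (a t).2)).1
    have e : r (t + 1) = f (σ.pos (a t).1) (a t).2 (σ.pos ((a t).1 ++ [(a t).2])) := by
      show (a (t + 1)).2 = _
      rw [ha]
    have e' : σ.cops r (t + 1) = σ.pos ((a t).1 ++ [(a t).2]) := by
      rw [CopStrategy.cops, ← hr, ha]
    rw [e, e']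
    exact h
  -- Both ends of a legal walk are free of cops, which rules out capture by either side's move; only
  -- the initial placement needs `hv₀`.
  obtain ⟨t, i, h | h⟩ := hwin r fun t _ => hmove t
  · cases t with
    | zero => exact hv₀ i h
    | succ t =>
      obtain ⟨w, -, hw⟩ := hmove t
      exact hw _ w.end_mem_support i h
  · obtain ⟨w, -, hw⟩ := hmove t
    exact hw _ w.start_mem_support i h

theorem two_pow_le_of_winning {n R m k M : ℕ} (hR : 40000 ≤ R) (hm : 60 ≤ m) (hk : k ≠ 0)
    (hT : ∀ i ≤ k, 1000 * ((m : ℤ) + 57) ^ i ≤ 10 ^ 4 * (m : ℤ) ^ i)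
    (hn : 2 * (10 ^ 4 * m ^ k) ≤ n) (σ : CopStrategy (gridGraph n) M) (hσ : σ.Winning R) :
    2 ^ k ≤ M := by
  classical
  by_contra! hM
  have hn' : 2 * (10 ^ 4 * (m : ℤ) ^ k) ≤ n := by exact_mod_cast hn
  have hcount : ∀ (c : Fin M → Fin n × Fin n) v r, copCount c v r < 2 ^ k := by
    intro c v r
    refine lt_of_le_of_lt ?_ hM
    simpa [copCount] using Finset.card_filter_le (Finset.univ : Finset (Fin M)) _
  have hL : 0 < 10 ^ 4 * (m : ℤ) ^ k := by positivity
  set L := 10 ^ 4 * (m : ℤ) ^ k with hLdef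
  set Base : GameState (Fin n × Fin n) M → Prop := fun s =>
    (InCell L 0 0 s.robber ∨ InCell L 1 0 s.robber) ∧ SafeBelow m k s.cops s.robber with hBase
  have hstep := cellStep (n := n) (M := M) hR hm k hT
  -- The target `P` is the other cell, so it fails at `s` and forcing it takes at least one turn;
  -- this is what keeps the robber moving forever.
  have hbase : ∀ s, Base s → ∃ P : GameState (Fin n × Fin n) M → Prop, ¬ P s ∧
      (∀ s', P s' → Base s') ∧ RobberForces (gridGraph n) R P s := by
    rintro s ⟨h | h, hs⟩
    · refine ⟨_, ?_, ?_, hstep s 0 0 1 0 (by norm_num) (by norm_num) (by norm_num) (by norm_num)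
        (by norm_num) (by linarith) (by linarith) (by linarith) (by linarith) h hs (hcount _ _ _)⟩
      · rintro ⟨-, h', -⟩
        have := h.2.1
        have := h'.1
        linarith
      · rintro s' ⟨-, h1, h2⟩
        exact ⟨.inr h1, h2⟩
    · refine ⟨_, ?_, ?_, hstep s 1 0 0 0 (by norm_num) (by norm_num) (by norm_num) (by norm_num)
        (by norm_num) (by linarith) (by linarith) (by linarith) (by linarith) h hs (hcount _ _ _)⟩
      · rintro ⟨-, h', -⟩
        have := h.1
        have := h'.2.1
        linarith
      · rintro s' ⟨-, h1, h2⟩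
        exact ⟨.inl h1, h2⟩
  refine not_winning_of_invariant
    (fun c v => ∃ t, RobberForces (gridGraph n) R Base ⟨t, c, v⟩) ?_ ?_ σ hσ
  · intro c
    obtain ⟨v, hv, hs⟩ := exists_safe hm c k 0 0 le_rfl le_rfl (by linarith) (by linarith)
      fun v _ => hcount _ _ _
    refine ⟨v, fun i hi => ?_, 0, .done _ ⟨.inl hv, hs⟩⟩
    -- Level 0 safety means no cop nearby, so the initial square is free; this level is present
    -- because `k ≠ 0`.
    have := hs 0 (Nat.pos_of_ne_zero hk)
    rw [pow_zero, pow_zero, Nat.lt_one_iff, copCount, Finset.card_eq_zero, Finset.filter_eq_empty_iff] at this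
    refine this (Finset.mem_univ i) ?_
    rw [hi]
    simp [GridNear]
  · rintro c v ⟨t, h⟩ c' hc'
    have key : ∀ {P : GameState (Fin n × Fin n) M → Prop} {s}, RobberForces (gridGraph n) R P s →
        (∀ s', P s' → Base s') → ¬ P s → ∀ c', CopMove (gridGraph n) s.cops c' →
        ∃ v', RobberMove (gridGraph n) R c' s.robber v' ∧
          ∃ t, RobberForces (gridGraph n) R Base ⟨t, c', v'⟩ := by
      intro P s h hP hnot c' hc'
      cases h with
      | done _ h => exact absurd h hnot
      | step _ f hmove hrec => exact ⟨f c', hmove c' hc', s.time + 1, (hrec c' hc').mono hP⟩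
    by_cases hb : Base ⟨t, c, v⟩
    · obtain ⟨P, hP, hPB, hf⟩ := hbase _ hb
      exact key hf hPB hP c' hc'
    · exact key h (fun _ h => h) hb c' hc'

/-! ### Choice of parameters -/

/-- The ratio of the powers is at most `(1 + 1 / k) ^ k ≤ e < 3`, well below the available factor
10. -/
theorem speed_loss_bound {k : ℕ} (i : ℕ) (hi : i ≤ k) :
    1000 * (((60 * k : ℕ) : ℤ) + 57) ^ i ≤ 10 ^ 4 * ((60 * k : ℕ) : ℤ) ^ i := by
  rcases Nat.eq_zero_or_pos k with rfl | hk
  · obtain rfl : i = 0 := by omega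
    norm_num
  have hk' : (0 : ℝ) < k := by exact_mod_cast hk
  have key : ((60 * k : ℝ) + 57) ^ i ≤ 3 * (60 * k : ℝ) ^ i := by
    have h1 : (60 * k : ℝ) + 57 ≤ (60 * k) * Real.exp (1 / k) := by
      have := Real.add_one_le_exp (1 / (k : ℝ))
      have h2 : (60 * k : ℝ) * (1 / k + 1) ≤ (60 * k) * Real.exp (1 / k) := by gcongr
      have h3 : (60 * k : ℝ) * (1 / k + 1) = 60 * k + 60 := by field_simp; ring
      linarith
    calc ((60 * k : ℝ) + 57) ^ i ≤ ((60 * k) * Real.exp (1 / k)) ^ i := by gcongr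
      _ = Real.exp (i * (1 / k)) * (60 * k : ℝ) ^ i := by rw [mul_pow, ← Real.exp_nat_mul]; ring
      _ ≤ 3 * (60 * k : ℝ) ^ i := by
        gcongr
        have : (i : ℝ) * (1 / k) ≤ 1 := by
          rw [mul_one_div, div_le_one hk']
          exact_mod_cast hi
        exact (Real.exp_le_exp.2 this).trans (by linarith [Real.exp_one_lt_d9])
  have hpos : (0 : ℝ) ≤ (60 * k : ℝ) ^ i := by positivity
  have : (1000 : ℝ) * ((60 * k : ℝ) + 57) ^ i ≤ 10 ^ 4 * (60 * k : ℝ) ^ i := by linarith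
  exact_mod_cast this

theorem two_pow_le_gridCopNumber {R n k : ℕ} (hR : 40000 ≤ R) (hk : k ≠ 0)
    (hn : 2 * (10 ^ 4 * (60 * k) ^ k) ≤ n) : 2 ^ k ≤ gridCopNumber R n := by
  refine le_csInf (exists_winning_copStrategy (gridGraph n) R) ?_
  rintro M ⟨σ, hσ⟩
  exact two_pow_le_of_winning hR (by omega) hk (fun i hi => speed_loss_bound i hi) hn σ hσ

open Filter in
theorem theorem1 :
    ∃ c : ℝ, 0 < c ∧ ∀ᶠ n : ℕ in Filter.atTop,
      Real.exp (c * Real.log (n : ℝ) / Real.log (Real.log (n : ℝ))) ≤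
        (gridCopNumber (10 ^ 25) n : ℝ) := by
  -- With `k ≥ (log n / (2 * log log n)) / 2` after rounding down, and `log 2 ≥ 1 / 2`, the exponent
  -- `k * log 2` is at least `log n / (8 * log log n)`.
  refine ⟨1 / 8, by norm_num, ?_⟩
  have hlog : Tendsto (fun n : ℕ => Real.log (n : ℝ)) atTop atTop :=
    Real.tendsto_log_atTop.comp tendsto_natCast_atTop_atTop
  have hloglog : Tendsto (fun n : ℕ => Real.log (Real.log (n : ℝ))) atTop atTop :=
    Real.tendsto_log_atTop.comp hlog
  filter_upwards [hloglog.eventually_ge_atTop 100, hlog.eventually_ge_atTop 100,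
    eventually_gt_atTop 0] with n hy hx hn0
  set x := Real.log (n : ℝ) with hxdef
  set y := Real.log x with hydef
  have hx0 : 0 < x := by linarith
  have hy0 : 0 < y := by linarith
  have hxy : y ≤ x / 10 := by
    have h := Real.log_le_sub_one_of_pos (show 0 < x / 20 by positivity)
    rw [Real.log_div hx0.ne' (by norm_num)] at h
    have h20 : Real.log 20 ≤ 1 + 2 := by
      have h400 : (20 : ℝ) ≤ Real.exp 1 ^ 3 := by
        have := Real.exp_one_gt_d9
        calc (20 : ℝ) ≤ 2.718 ^ 3 := by norm_num
          _ ≤ _ := by gcongr; linarith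
      rw [Real.log_le_iff_le_exp (by norm_num)]
      rw [← Real.exp_nat_mul] at h400
      norm_num at h400 ⊢
      exact h400
    linarith
  set k := ⌊x / (2 * y)⌋₊ with hkdef
  have hk_le : (k : ℝ) ≤ x / (2 * y) := Nat.floor_le (by positivity)
  have hk_lt : x / (2 * y) < k + 1 := Nat.lt_floor_add_one _
  have hone : 5 ≤ x / (2 * y) := by
    rw [le_div_iff₀ (by positivity)]
    linarith
  have hk1 : 1 ≤ k := Nat.le_floor (by push_cast; linarith)
  have hk1' : (1 : ℝ) ≤ k := by exact_mod_cast hk1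
  have hkey : (k : ℝ) * (2 * y) ≤ x := by
    rwa [le_div_iff₀ (by positivity)] at hk_le
  have hbound : 2 * (10 ^ 4 * (60 * k) ^ k) ≤ n := by
    have hlogk : Real.log k ≤ y := by
      refine Real.log_le_log (by linarith) ?_
      nlinarith
    have h60 : Real.log 60 ≤ 59 := by
      have := Real.log_le_sub_one_of_pos (show (0 : ℝ) < 60 by norm_num)
      linarith
    have h20000 : Real.log 20000 ≤ 20 := by
      rw [Real.log_le_iff_le_exp (by norm_num)]
      have h2 : (2 : ℝ) ≤ Real.exp 1 := by linarith [Real.exp_one_gt_d9]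
      calc (20000 : ℝ) ≤ 2 ^ 20 := by norm_num
        _ ≤ Real.exp 1 ^ 20 := by gcongr
        _ = Real.exp 20 := by rw [← Real.exp_nat_mul]; norm_num
    have : (20000 : ℝ) * (60 * k) ^ k ≤ n := by
      rw [← Real.log_le_log_iff (by positivity) (by exact_mod_cast hn0),
        Real.log_mul (by norm_num) (by positivity), Real.log_pow,
        Real.log_mul (by norm_num) (by positivity)]
      have : (k : ℝ) * (Real.log 60 + Real.log k) ≤ k * (59 + y) := by gcongr
      -- Since `y ≥ 100` and `k ≥ 1`, `20 + k * (59 + y) ≤ 2 * k * y ≤ x`; the factor 2 in the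
      -- choice of `k` pays for the constants.
      nlinarith
    have h' : 20000 * (60 * k) ^ k ≤ n := by exact_mod_cast this
    omega
  have hfinal := two_pow_le_gridCopNumber (R := 10 ^ 25) (by norm_num) (by omega) hbound
  have hcast : (2 : ℝ) ^ k ≤ (gridCopNumber (10 ^ 25) n : ℝ) := by exact_mod_cast hfinal
  refine le_trans ?_ hcast
  rw [← Real.exp_log (show (0 : ℝ) < 2 ^ k by positivity), Real.exp_le_exp, Real.log_pow]
  have hlog2 : 1 / 2 ≤ Real.log 2 := by linarith [Real.log_two_gt_d9]
  have e : 1 / 8 * x / y = 1 / 4 * (x / (2 * y)) := by field_simp; norm_num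
  rw [e]
  nlinarith
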